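/- All graphs and trees are finite. A \emph{Burling tree} is a 4-tuple $(T,r,\ell,c)$ where $T$ is a tree rooted at $r$; $\ell$ associates to each non-leaf vertex $v$ of $T$ one child of $v$, called the \emph{last-born} of $v$; and $c$ is defined on $V(T)$ as follows: if $v\neq r$ is not a last-born, $c(v)$ is the vertex set of a (possibly empty) branch (a path descending from parent to child) of $T$ starting at the last-born of the parent of $v$, and if $v$ is a last-born or $v=r$, then $c(v)=\varnothing$. The oriented graph \emph{fully derived} from $T$ has vertex set $V(T)$ and an arc $uv$ if and only if $v\in c(u)$; the non-oriented graph fully derived from $T$ is its underlying graph. A graph (oriented or not) is \emph{derived from $T$} if it is (isomorphic to) an induced subgraph of the (oriented or not) graph fully derived from $T$, and it is a \emph{derived graph} if it is derived from some Burling tree. A \emph{hole} of a graph is a chordless cycle of length at least $4$; a hole of an oriented graph is a hole of its underlying graph. Let $H$ be a hole of an oriented graph derived from a Burling tree $T$. The \emph{antennas} of $H$ are the sources of $H$, i.e. the vertices of $H$ with no in-neighbor in $H$ (there are exactly two of them); the \emph{pivot} of $H$ is the common neighbor of the antennas in $H$ that is an ancestor in $T$ of all vertices of $H$ other than the antennas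 (every vertex being an ancestor of itself); a \emph{subordinate} vertex of $H$ is a vertex of $H$ that is neither an antenna nor the pivot of $H$. A vertex $v$ of a non-oriented derived graph $G$ is a \emph{global subordinate} vertex of $G$ if for every oriented graph $\tilde G$ derived from a Burling tree $T$ whose underlying graph is $G$, $v$ is a subordinate vertex (with respect to $T$) of some hole of $\tilde G$; the hole may depend on $\tilde G$, on $T$ and on how $\tilde G$ is derived from $T$. A \emph{dumbbell} of graphs $G_1$ and $G_2$ with respect to vertices $x_1\in V(G_1)$ and $x_2\in V(G_2)$ is any graph obtained from the disjoint union of $G_1$ and $G_2$ by connecting $x_1$ and $x_2$ by a path of length at least $0$ whose internal vertices are new (a path of length $0$ means that $x_1$ and $x_2$ are identified). \textbf{Lemma.} Let $G_1$ and $G_2$ be two derived graphs, and let $x_1\in V(G_1)$ and $x_2\in V(G_2)$. If $x_i$ is a global subordinate vertex of $G_i$ for $i=1,2$, then any dumbbell of $G_1$ and $G_2$ with respect to $x_1$ and $x_2$ is not a derived graph. -/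

import Mathlib

/-- A (finite) Burling tree. Rooted trees are Mathlib's order-theoretic `RootedTree`: the root is `⊥`,
the parent of a vertex `v ≠ ⊥` is `Order.pred v`, `a ≤ b` means that `a` is an ancestor of `b`
(possibly `a = b`), and the leaves are the maximal elements. -/
structure BurlingTree where
  /-- The underlying rooted tree. -/
  tree : RootedTree.{0}
  finite : Finite tree
  /-- `lastBorn v` is the last-born of `v`; its value is irrelevant if `v` is a leaf. -/
  lastBorn : tree → tree
  /-- The last-born of a vertex that is not a leaf is one of its children. -/
  covBy_lastBorn : ∀ v : tree, ¬ IsMax v → v ⋖ lastBorn v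
  /-- The choose function. -/
  choosePath : tree → Set tree
  /-- If `v` is neither the root nor a last-born, then `choosePath v` is the vertex set of a possibly
  empty branch that starts at the last-born of the parent of `v`. The nonempty branch that goes
  down from `a` to `b` has vertex set `Set.Icc a b`. -/
  choosePath_branch : ∀ v : tree, v ≠ ⊥ → lastBorn (Order.pred v) ≠ v →
    choosePath v = ∅ ∨
      ∃ b : tree, lastBorn (Order.pred v) ≤ b ∧
        choosePath v = Set.Icc (lastBorn (Order.pred v)) b
  /-- The root and the last-borns choose nothing. -/
  choosePath_empty : ∀ v : tree, v = ⊥ ∨ lastBorn (Order.pred v) = v → choosePath v = ∅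

/-- The oriented graph fully derived from a Burling tree: `uv` is an arc iff `v` is in
`choosePath u`. -/
def BurlingTree.fullyDerived (T : BurlingTree) : Digraph T.tree where
  Adj u v := v ∈ T.choosePath u

/-- `DerivedEmbedding D T` exhibits the oriented graph `D` as an induced subgraph of the oriented
graph fully derived from `T`. So `D` is an oriented graph derived from `T` iff this type is
nonempty. -/
abbrev DerivedEmbedding {V : Type*} (D : Digraph V) (T : BurlingTree) :=
  D.Adj ↪r T.fullyDerived.Adj

/-- A non-oriented graph is a derived graph if it is an induced subgraph of the underlying graph of
the oriented graph fully derived from some Burling tree. -/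
def IsDerivedGraph {V : Type*} (G : SimpleGraph V) : Prop :=
  ∃ T : BurlingTree, Nonempty (G ↪g T.fullyDerived.toSimpleGraphInclusive)

/-- `H` is the vertex set of a hole of `G`, i.e. of a chordless cycle of length at least 4. -/
def IsHole {V : Type*} (G : SimpleGraph V) (H : Set V) : Prop :=
  ∃ (u : V) (c : G.Walk u u), c.IsCycle ∧ 4 ≤ c.length ∧ c.IsChordless ∧ H = {v | v ∈ c.support}

/-- The antennas of a hole `H` of an oriented derived graph are the sources of `H`. -/
def IsAntenna {V : Type*} (D : Digraph V) (H : Set V) (a : V) : Prop :=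
  a ∈ H ∧ ∀ u ∈ H, ¬ D.Adj u a

/-- The pivot of a hole `H` of an oriented graph derived from `T`: the common (out-)neighbor of the
antennas of `H` that is an ancestor in `T` of all vertices of `H` but the antennas. -/
def IsPivot {V : Type*} (D : Digraph V) {T : BurlingTree} (φ : DerivedEmbedding D T)
    (H : Set V) (p : V) : Prop :=
  p ∈ H ∧ (∀ a, IsAntenna D H a → D.Adj a p) ∧
    ∀ w ∈ H, ¬ IsAntenna D H w → φ p ≤ φ w

/-- The subordinate vertices of a hole are its vertices other than the pivot and the antennas. -/
def IsSubordinate {V : Type*} (D : Digraph V) {T : BurlingTree} (φ : DerivedEmbedding D T)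
    (H : Set V) (v : V) : Prop :=
  v ∈ H ∧ ¬ IsAntenna D H v ∧ ¬ IsPivot D φ H v

/-- `v` is a global subordinate vertex of `G`: for every oriented derived graph `D` with underlying
graph `G` (derived from any Burling tree in any way), `v` is a subordinate vertex of some hole. -/
def IsGlobalSubordinate {V : Type*} (G : SimpleGraph V) (v : V) : Prop :=
  ∀ D : Digraph V, D.toSimpleGraphInclusive = G →
    ∀ (T : BurlingTree) (φ : DerivedEmbedding D T),
      ∃ H : Set V, IsHole G H ∧ IsSubordinate D φ H v

/-- `D` is (up to isomorphism) a dumbbell of `G₁` and `G₂` with respect to `x₁` and `x₂`: it is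
made of a copy of `G₁`, a copy of `G₂` and a path of length at least 0 (length 0 means that `x₁` and
`x₂` are identified) from `x₁` to `x₂`, which are otherwise disjoint, and it has no other vertices
and no other edges. -/
def IsDumbbell {V₁ V₂ W : Type*} (G₁ : SimpleGraph V₁) (G₂ : SimpleGraph V₂)
    (x₁ : V₁) (x₂ : V₂) (D : SimpleGraph W) : Prop :=
  ∃ (f₁ : G₁ ↪g D) (f₂ : G₂ ↪g D) (p : D.Walk (f₁ x₁) (f₂ x₂)),
    p.IsPath ∧
    Set.range f₁ ∩ {w | w ∈ p.support} = {f₁ x₁} ∧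
    Set.range f₂ ∩ {w | w ∈ p.support} = {f₂ x₂} ∧
    Set.range f₁ ∩ Set.range f₂ = {f₁ x₁} ∩ {f₂ x₂} ∧
    (∀ w, w ∈ Set.range f₁ ∨ w ∈ Set.range f₂ ∨ w ∈ p.support) ∧
    ∀ u v, D.Adj u v →
      (∃ a b, G₁.Adj a b ∧ f₁ a = u ∧ f₁ b = v) ∨
      (∃ a b, G₂.Adj a b ∧ f₂ a = u ∧ f₂ b = v) ∨
      s(u, v) ∈ p.edges

/-!
The argument compares, in the Burling tree `T` of a putative derivation of the dumbbell, the pivots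
of two holes.

*Trapping.* Let `p` be a strict ancestor of `v`, and let `w` be adjacent to `v`. Either `w` is also a
strict descendant of `p`, or there is an arc from `w` to `p`
(`BurlingTree.lt_or_adj_of_lt_of_adj`): if there is an arc from `w` to `v` and the parent of `w` is a
strict ancestor of `p`, then the branch chosen by `w`, which contains `v`, contains `p` as well.
Hence a connected set that contains a strict descendant of `p` and avoids the neighbors of `p`
consists of strict descendants of `p`.

*Pivots.* Trapping, applied along a hole with `p` the upper out-neighbor of a source, shows that
every hole has a pivot (`IsHole.exists_isPivot`), which is therefore a strict ancestor of each
subordinate vertex of the hole (`IsSubordinate.exists_lt`).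

*Dumbbells.* If `D` is a derived dumbbell of `G₁` and `G₂`, then the orientations and embeddings that
`G₁` and `G₂` inherit make `xᵢ` a subordinate vertex of a hole of `Gᵢ`, say with pivot `pᵢ`. The
vertex `p₁` is a strict ancestor of `x₁` and has no neighbor outside `G₁`, so the path and all of
`G₂` are trapped below `p₁`; in particular `p₁ < p₂`. By symmetry `p₂ < p₁`, a contradiction.
-/

open SimpleGraph

/-! ### Arcs of fully derived graphs -/

namespace BurlingTree

variable {T : BurlingTree} {u v w p q : T.tree}

theorem ne_bot_of_adj (h : T.fullyDerived.Adj u v) : u ≠ ⊥ := by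
  intro hu
  have h' : v ∈ T.choosePath u := h
  simp [T.choosePath_empty u (Or.inl hu)] at h'

theorem lastBorn_pred_ne_of_adj (h : T.fullyDerived.Adj u v) :
    T.lastBorn (Order.pred u) ≠ u := by
  intro hu
  have h' : v ∈ T.choosePath u := h
  simp [T.choosePath_empty u (Or.inr hu)] at h'

theorem choosePath_eq_of_adj (h : T.fullyDerived.Adj u v) :
    ∃ b, T.choosePath u = Set.Icc (T.lastBorn (Order.pred u)) b := by
  have h' : v ∈ T.choosePath u := h
  rcases T.choosePath_branch u (ne_bot_of_adj h) (lastBorn_pred_ne_of_adj h) with h0 | ⟨b, -, hb⟩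
  · simp [h0] at h'
  · exact ⟨b, hb⟩

theorem lastBorn_pred_le_of_adj (h : T.fullyDerived.Adj u v) :
    T.lastBorn (Order.pred u) ≤ v := by
  obtain ⟨b, hb⟩ := choosePath_eq_of_adj h
  have h' : v ∈ T.choosePath u := h
  rw [hb] at h'
  exact h'.1

theorem pred_lt_self (hu : u ≠ ⊥) : Order.pred u < u :=
  Order.pred_lt_of_not_isMin fun h => hu h.eq_bot

theorem pred_covBy_lastBorn (hu : u ≠ ⊥) : Order.pred u ⋖ T.lastBorn (Order.pred u) :=
  T.covBy_lastBorn _ fun h => (pred_lt_self hu).not_ge (h (pred_lt_self hu).le)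

theorem pred_lt_of_adj (h : T.fullyDerived.Adj u v) : Order.pred u < v :=
  (pred_covBy_lastBorn (ne_bot_of_adj h)).lt.trans_le (lastBorn_pred_le_of_adj h)

theorem pred_le_pred_of_adj (h : T.fullyDerived.Adj u v) : Order.pred u ≤ Order.pred v :=
  Order.le_pred_of_lt (pred_lt_of_adj h)

theorem le_or_le_of_adj_of_adj (hv : T.fullyDerived.Adj u v) (hw : T.fullyDerived.Adj u w) :
    v ≤ w ∨ w ≤ v := by
  obtain ⟨b, hb⟩ := choosePath_eq_of_adj hv
  have hv' : v ∈ T.choosePath u := hv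
  have hw' : w ∈ T.choosePath u := hw
  rw [hb] at hv' hw'
  exact (le_total_of_directed hv'.2 hw'.2).symm

/-- Arcs to `v` are also arcs to the ancestors of `v` that lie at or below the last-born
at which the branch chosen by `u` starts. -/
theorem adj_of_le_of_adj (h : T.fullyDerived.Adj u v) (hq : T.lastBorn (Order.pred u) ≤ q)
    (hqv : q ≤ v) : T.fullyDerived.Adj u q := by
  obtain ⟨b, hb⟩ := choosePath_eq_of_adj h
  have h' : v ∈ T.choosePath u := h
  change q ∈ T.choosePath u
  rw [hb] at h' ⊢
  exact ⟨hq, hqv.trans h'.2⟩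

theorem not_le_of_adj (h : T.fullyDerived.Adj u v) : ¬ u ≤ v := by
  intro huv
  have hne := lastBorn_pred_ne_of_adj h
  have hcov := pred_covBy_lastBorn (ne_bot_of_adj h)
  have hlt := pred_lt_self (ne_bot_of_adj h)
  rcases le_total_of_directed huv (lastBorn_pred_le_of_adj h) with h1 | h1
  · exact (Order.pred_covBy_of_not_isMin fun h' => ne_bot_of_adj h h'.eq_bot).2 hcov.lt
      (lt_of_le_of_ne h1 hne)
  · exact hcov.2 hlt (lt_of_le_of_ne h1 hne.symm)

theorem not_ge_of_adj (h : T.fullyDerived.Adj u v) : ¬ v ≤ u := fun hvu =>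
  (Order.pred_covBy_of_not_isMin fun h' => ne_bot_of_adj h h'.eq_bot).2
    (pred_covBy_lastBorn (ne_bot_of_adj h)).lt
    (lt_of_le_of_ne ((lastBorn_pred_le_of_adj h).trans hvu) (lastBorn_pred_ne_of_adj h))

theorem ne_of_adj (h : T.fullyDerived.Adj u v) : u ≠ v := fun huv => not_le_of_adj h huv.le

/-- An arc between siblings ends at the last-born. -/
theorem lastBorn_pred_eq_of_adj (h : T.fullyDerived.Adj u v) (hp : Order.pred v ≤ Order.pred u) :
    T.lastBorn (Order.pred v) = v := by
  have heq : Order.pred v = Order.pred u := hp.antisymm (pred_le_pred_of_adj h)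
  by_contra hne
  rw [heq] at hne
  have h1 := Order.le_pred_of_lt (lt_of_le_of_ne (lastBorn_pred_le_of_adj h) hne)
  rw [heq] at h1
  exact (pred_covBy_lastBorn (ne_bot_of_adj h)).lt.not_ge h1

theorem not_adj_of_adj (h : T.fullyDerived.Adj u v) : ¬ T.fullyDerived.Adj v u := fun h' =>
  lastBorn_pred_ne_of_adj h' (lastBorn_pred_eq_of_adj h (pred_le_pred_of_adj h'))

/-- An arc that starts strictly below `p` ends strictly below `p`. -/
theorem lt_of_lt_of_adj (hp : p < v) (h : T.fullyDerived.Adj v w) : p < w :=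
  (Order.le_pred_of_lt hp).trans_lt (pred_lt_of_adj h)

/-- Trapping: the neighbors of a strict descendant of `p` are strict descendants of `p`, except for
those that have an arc to `p`. -/
theorem lt_or_adj_of_lt_of_adj (hp : p < v)
    (h : T.fullyDerived.Adj v w ∨ T.fullyDerived.Adj w v) : p < w ∨ T.fullyDerived.Adj w p := by
  rcases h with h | h
  · exact Or.inl (lt_of_lt_of_adj hp h)
  have hcov := pred_covBy_lastBorn (ne_bot_of_adj h)
  by_cases hpw : p ≤ Order.pred w
  · exact Or.inl (hpw.trans_lt (pred_lt_self (ne_bot_of_adj h)))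
  have hlt : Order.pred w < p :=
    lt_of_le_not_ge ((le_total_of_directed hp.le (pred_lt_of_adj h).le).resolve_right hpw) hpw
  refine Or.inr (adj_of_le_of_adj h ?_ hp.le)
  rcases le_total_of_directed hp.le (lastBorn_pred_le_of_adj h) with h1 | h1
  · exact h1
  · exact (h1.eq_or_lt.resolve_right (hcov.2 hlt)).ge

end BurlingTree

/-! ### Holes -/

/-- A hole can be traversed from any of its vertices towards any of its neighbors in the hole. -/
theorem IsHole.exists_cycle {V : Type*} {G : SimpleGraph V} {H : Set V} (hH : IsHole G H)
    {n a : V} (hn : n ∈ H) (ha : a ∈ H) (hna : G.Adj n a) :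
    ∃ c : G.Walk n n, c.IsCycle ∧ 4 ≤ c.length ∧ c.IsChordless ∧ H = {v | v ∈ c.support} ∧
      c.getVert 1 = a := by
  classical
  obtain ⟨u, c₀, hc₀, hl₀, hch₀, rfl⟩ := hH
  set c := c₀.rotate n hn with hc_def
  have hsupp : ∀ w, w ∈ c.support ↔ w ∈ c₀.support := fun w => Walk.mem_support_rotate_iff c₀ n hn
  have hcyc : c.IsCycle := hc₀.rotate hn
  have hlen : c.length = c₀.length := Walk.length_rotate c₀ n hn
  have hch : c.IsChordless := by
    rw [Walk.isChordless_iff_forall_mem_edges]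
    intro x y hx hy hxy
    exact (Walk.rotate_edges c₀ n hn).mem_iff.mpr
      (hch₀.mem_edges ((hsupp x).1 hx) ((hsupp y).1 hy) hxy)
  have hset : {v | v ∈ c₀.support} = {v | v ∈ c.support} := by
    ext w; exact (hsupp w).symm
  have he : s(n, a) ∈ c.edges := hch.mem_edges ((hsupp n).2 hn) ((hsupp a).2 ha) hna
  obtain ⟨i, hi, heq⟩ := (Walk.mk_mem_edges_iff_exists c).1 he
  rw [Sym2.eq_iff] at heq
  rcases heq with ⟨h1, h2⟩ | ⟨h1, h2⟩
  · have := (hcyc.getVert_endpoint_iff hi.le).1 h1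
    have hi0 : i = 0 := by lia
    subst hi0
    exact ⟨c, hcyc, hlen ▸ hl₀, hch, hset, h2⟩
  · have := (hcyc.getVert_endpoint_iff hi).1 h2
    have hi0 : c.length - 1 = i := by lia
    refine ⟨c.reverse, hcyc.reverse, by simpa [hlen] using hl₀, ?_, by simpa using hset, ?_⟩
    · rw [Walk.isChordless_iff_forall_mem_edges]
      intro x y hx hy hxy
      simp only [Walk.support_reverse, List.mem_reverse, Walk.edges_reverse] at hx hy ⊢
      exact hch.mem_edges hx hy hxy
    · rw [Walk.getVert_reverse, hi0, h1]

theorem IsHole.exists_adj {V : Type*} {G : SimpleGraph V} {H : Set V} (hH : IsHole G H)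
    {a : V} (ha : a ∈ H) : ∃ n ∈ H, G.Adj a n := by
  classical
  obtain ⟨u, c, hc, hl, -, rfl⟩ := hH
  refine ⟨(c.rotate a ha).getVert 1, ?_, ?_⟩
  · exact (Walk.mem_support_rotate_iff c a ha).1 (Walk.getVert_mem_support _ _)
  · have h := (c.rotate a ha).adj_getVert_succ (i := 0) (by rw [Walk.length_rotate]; lia)
    simpa using h

theorem IsHole.finite {V : Type*} {G : SimpleGraph V} {H : Set V} (hH : IsHole G H) :
    H.Finite := by
  obtain ⟨u, c, -, -, -, rfl⟩ := hH
  exact c.support.finite_toSet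

/-- In a chordless cycle, adjacent vertices have consecutive positions. -/
theorem SimpleGraph.Walk.IsCycle.eq_succ_of_adj_getVert {V : Type*} {G : SimpleGraph V} {n : V}
    {c : G.Walk n n} (hc : c.IsCycle) (hch : c.IsChordless) {i j : ℕ} (hij : i < j)
    (hj : j < c.length) (h : G.Adj (c.getVert i) (c.getVert j)) :
    j = i + 1 ∨ i = 0 ∧ j + 1 = c.length := by
  have hinj : ∀ {k l : ℕ}, k < c.length → l < c.length → c.getVert k = c.getVert l → k = l := by
    intro k l hk hl hkl
    exact hc.getVert_injOn' (by simp only [Set.mem_ofPred_eq]; lia)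
      (by simp only [Set.mem_ofPred_eq]; lia) hkl
  have he := hch.mem_edges (c.getVert_mem_support i) (c.getVert_mem_support j) h
  obtain ⟨k, hk, heq⟩ := (Walk.mk_mem_edges_iff_exists c).1 he
  rw [Sym2.eq_iff] at heq
  by_cases hk1 : k + 1 = c.length
  · rw [hk1, show c.getVert c.length = c.getVert 0 by simp] at heq
    rcases heq with ⟨h1, h2⟩ | ⟨h1, h2⟩
    · have := hinj hk (hij.trans hj) h1
      have := hinj (by lia) hj h2
      lia
    · have := hinj hk hj h1
      have := hinj (by lia) (hij.trans hj) h2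
      lia
  · rcases heq with ⟨h1, h2⟩ | ⟨h1, h2⟩
    · have := hinj hk (hij.trans hj) h1
      have := hinj (by lia) hj h2
      lia
    · have := hinj hk hj h1
      have := hinj (by lia) (hij.trans hj) h2
      lia

/-! ### Pivots -/

section Pivot

variable {V : Type*} {D : Digraph V} {T : BurlingTree} {H : Set V}

theorem DerivedEmbedding.adj_iff (φ : DerivedEmbedding D T) {a b : V} :
    T.fullyDerived.Adj (φ a) (φ b) ↔ D.Adj a b := φ.map_rel_iff

theorem Digraph.adj_or_adj_of_adj_toSimpleGraphInclusive {a b : V}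
    (h : D.toSimpleGraphInclusive.Adj a b) : D.Adj a b ∨ D.Adj b a := h.2

theorem DerivedEmbedding.adj_toSimpleGraphInclusive (φ : DerivedEmbedding D T) {a b : V}
    (h : D.Adj a b) : D.toSimpleGraphInclusive.Adj a b :=
  ⟨fun hab => BurlingTree.ne_of_adj ((DerivedEmbedding.adj_iff φ).2 h) (congrArg φ hab), Or.inl h⟩

/-- The upper out-neighbor `n` of a source `a` of a hole has exactly one other neighbor `b` in the
hole; this `b` is a source too, and all other vertices of the hole are trapped below `n`. -/
theorem IsHole.exists_forall_lt_of_isAntenna (hH : IsHole D.toSimpleGraphInclusive H)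
    (φ : DerivedEmbedding D T) {a : V} (ha : IsAntenna D H a) :
    ∃ n b, n ∈ H ∧ IsAntenna D H b ∧ D.Adj a n ∧ D.Adj b n ∧
      ∀ w ∈ H, w = a ∨ w = b ∨ w = n ∨ φ n < φ w := by
  have hout : ∀ w ∈ H, D.toSimpleGraphInclusive.Adj a w → D.Adj a w := fun w hw h =>
    (D.adj_or_adj_of_adj_toSimpleGraphInclusive h).resolve_right (ha.2 w hw)
  obtain ⟨n, ⟨hnH, han⟩, hmin⟩ := (hH.finite.subset
      (Set.sep_subset H fun w => D.Adj a w)).exists_minimalFor φ _ (by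
    obtain ⟨m, hm, ham⟩ := hH.exists_adj ha.1
    exact ⟨m, hm, hout m hm ham⟩)
  obtain ⟨c, hc, hl, hch, hset, hc1⟩ :=
    hH.exists_cycle hnH ha.1 (DerivedEmbedding.adj_toSimpleGraphInclusive φ han).symm
  have hmem : ∀ i, c.getVert i ∈ H := fun i => by
    rw [hset]; exact c.getVert_mem_support i
  have hadj : ∀ i, i < c.length → T.fullyDerived.Adj (φ (c.getVert i)) (φ (c.getVert (i + 1))) ∨
      T.fullyDerived.Adj (φ (c.getVert (i + 1))) (φ (c.getVert i)) := fun i hi => by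
    simpa only [DerivedEmbedding.adj_iff] using
      D.adj_or_adj_of_adj_toSimpleGraphInclusive (c.adj_getVert_succ hi)
  have hinj : ∀ {k l : ℕ}, k < c.length → l < c.length → c.getVert k = c.getVert l → k = l := by
    intro k l hk hl hkl
    exact hc.getVert_injOn' (by simp only [Set.mem_ofPred_eq]; lia)
      (by simp only [Set.mem_ofPred_eq]; lia) hkl
  -- The vertices of the hole other than `a`, `n` and the other neighbor of `n` form a path, which
  -- starts at the other out-neighbor of `a` and is trapped below `n`. In the traversal `c`, `n` has
  -- position `0`, `a` position `1`, and the path positions `2` to `c.length - 2`.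
  have hlt : ∀ i, i + 2 < c.length - 1 → φ n < φ (c.getVert (i + 2)) := by
    intro i
    induction i with
    | zero =>
      intro _
      have ha2 : D.Adj a (c.getVert 2) := by
        refine hout _ (hmem 2) ?_
        have := c.adj_getVert_succ (i := 1) (by lia)
        rwa [hc1] at this
      have hne : φ n ≠ φ (c.getVert 2) := fun h => by
        have := hinj (k := 0) (l := 2) (by lia) (by lia) (by simpa using φ.injective h)
        lia
      refine lt_of_le_of_ne ?_ hne
      rcases BurlingTree.le_or_le_of_adj_of_adj ((DerivedEmbedding.adj_iff φ).2 han)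
        ((DerivedEmbedding.adj_iff φ).2 ha2) with h | h
      · exact h
      · exact hmin ⟨hmem 2, ha2⟩ h
    | succ i ih =>
      intro hi
      refine (BurlingTree.lt_or_adj_of_lt_of_adj (ih (by lia)) (hadj _ (by lia))).resolve_right ?_
      intro h
      have h' := (DerivedEmbedding.adj_toSimpleGraphInclusive φ
        ((DerivedEmbedding.adj_iff φ).1 h)).symm
      nth_rewrite 1 [← c.getVert_zero] at h'
      have := hc.eq_succ_of_adj_getVert hch (i := 0) (by lia) (by lia) h'
      lia
  obtain ⟨L, hL⟩ : ∃ L, c.length = L + 4 := ⟨c.length - 4, by lia⟩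
  have hz : φ n < φ (c.getVert (L + 2)) := hlt L (by lia)
  have hbn : D.Adj (c.getVert (L + 3)) n ∨ D.Adj n (c.getVert (L + 3)) := by
    have h := c.adj_getVert_succ (i := L + 3) (by lia)
    rw [show L + 3 + 1 = c.length by lia, Walk.getVert_length] at h
    exact D.adj_or_adj_of_adj_toSimpleGraphInclusive h
  -- The other neighbor `c.getVert (L + 3)` of `n` is not below `n`: adjacent vertices are incomparable.
  have hnb : ¬ φ n < φ (c.getVert (L + 3)) := fun h => by
    rcases hbn with h' | h'
    · exact BurlingTree.not_ge_of_adj ((DerivedEmbedding.adj_iff φ).2 h') h.le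
    · exact BurlingTree.not_le_of_adj ((DerivedEmbedding.adj_iff φ).2 h') h.le
  have hb : D.Adj (c.getVert (L + 3)) n := (DerivedEmbedding.adj_iff φ).1
    ((BurlingTree.lt_or_adj_of_lt_of_adj hz (hadj _ (by lia))).resolve_left hnb)
  refine ⟨n, c.getVert (L + 3), hnH, ⟨hmem _, ?_⟩, han, hb, ?_⟩
  · intro w hw hwb
    rw [hset] at hw
    obtain ⟨i, rfl, hi⟩ := Walk.mem_support_iff_exists_getVert.1 hw
    have hφ := (DerivedEmbedding.adj_iff φ).2 hwb
    have hna := BurlingTree.not_adj_of_adj ((DerivedEmbedding.adj_iff φ).2 hb)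
    rcases lt_trichotomy i (L + 3) with h | h | h
    · rcases hc.eq_succ_of_adj_getVert hch h (by lia)
        (DerivedEmbedding.adj_toSimpleGraphInclusive φ hwb) with h1 | ⟨rfl, -⟩
      · obtain rfl : i = L + 2 := by lia
        exact hnb (BurlingTree.lt_of_lt_of_adj hz hφ)
      · rw [Walk.getVert_zero] at hφ
        exact hna hφ
    · subst h
      exact BurlingTree.ne_of_adj hφ rfl
    · obtain rfl : i = c.length := by lia
      rw [Walk.getVert_length] at hφ
      exact hna hφ
  · intro w hw
    rw [hset] at hw
    obtain ⟨i, rfl, hi⟩ := Walk.mem_support_iff_exists_getVert.1 hw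
    match i, hi with
    | 0, _ => simp
    | 1, _ => exact Or.inl hc1
    | i + 2, hi =>
      by_cases h1 : i + 2 < c.length - 1
      · exact Or.inr (Or.inr (Or.inr (hlt i h1)))
      by_cases h2 : i = L + 1
      · exact Or.inr (Or.inl (by rw [h2]))
      · have : i + 2 = c.length := by lia
        exact Or.inr (Or.inr (Or.inl (by rw [this, Walk.getVert_length])))

theorem IsHole.exists_isAntenna (hH : IsHole D.toSimpleGraphInclusive H)
    (φ : DerivedEmbedding D T) : ∃ a, IsAntenna D H a := by
  have hne : H.Nonempty := by
    obtain ⟨u, c, -, -, -, rfl⟩ := hH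
    exact ⟨u, c.start_mem_support⟩
  -- Take `v` such that no vertex of `H` has a parent strictly above that of `v`. An in-neighbor `u`
  -- of `v` is then a sibling of `v`. An in-neighbor of `u` would likewise be a sibling of `u`, which
  -- makes `u` a last-born and hence a sink.
  obtain ⟨v, hv, hmin⟩ := hH.finite.exists_minimalFor (fun v => Order.pred (φ v)) _ hne
  by_cases hs : IsAntenna D H v
  · exact ⟨v, hs⟩
  obtain ⟨u, hu, huv⟩ : ∃ u ∈ H, D.Adj u v := by
    by_contra! h
    exact hs ⟨hv, h⟩
  refine ⟨u, hu, fun w hw hwu => ?_⟩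
  have huv' := (DerivedEmbedding.adj_iff φ).2 huv
  have hwu' := (DerivedEmbedding.adj_iff φ).2 hwu
  have hle := BurlingTree.pred_le_pred_of_adj huv'
  exact BurlingTree.lastBorn_pred_ne_of_adj huv' (BurlingTree.lastBorn_pred_eq_of_adj hwu'
    (hle.trans (hmin hw ((BurlingTree.pred_le_pred_of_adj hwu').trans hle))))

theorem IsHole.exists_isPivot (hH : IsHole D.toSimpleGraphInclusive H)
    (φ : DerivedEmbedding D T) : ∃ p, IsPivot D φ H p := by
  obtain ⟨a, ha⟩ := hH.exists_isAntenna φ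
  obtain ⟨n, b, hn, hb, han, hbn, hrest⟩ := hH.exists_forall_lt_of_isAntenna φ ha
  refine ⟨n, hn, fun w hw => ?_, fun w hw hwa => ?_⟩
  · rcases hrest w hw.1 with rfl | rfl | rfl | hnw
    · exact han
    · exact hbn
    · exact absurd han (hw.2 a ha.1)
    · -- A source `w` below `n` would have an upper out-neighbor `m`, with `n < m` and `m < n`.
      by_contra hwn
      obtain ⟨m, b', hm, hb', hwm, -, hrest'⟩ := hH.exists_forall_lt_of_isAntenna φ hw
      have hns : ¬ IsAntenna D H n := fun h => h.2 a ha.1 han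
      have hms : ¬ IsAntenna D H m := fun h => h.2 w hw.1 hwm
      rcases hrest' n hn with rfl | rfl | rfl | hmn
      · exact hns hw
      · exact hns hb'
      · exact hwn hwm
      rcases hrest m hm with rfl | rfl | rfl | hnm
      · exact hms ha
      · exact hms hb
      · exact hwn hwm
      exact lt_asymm hmn hnm
  · rcases hrest w hw with rfl | rfl | rfl | hnw
    · exact absurd ha hwa
    · exact absurd hb hwa
    · exact le_rfl
    · exact hnw.le

/-- A subordinate vertex of a hole is a strict descendant of some vertex of the hole, namely of
the pivot. -/
theorem IsSubordinate.exists_lt {φ : DerivedEmbedding D T} {v : V}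
    (hv : IsSubordinate D φ H v) (hH : IsHole D.toSimpleGraphInclusive H) :
    ∃ p ∈ H, φ p < φ v := by
  obtain ⟨p, hp⟩ := hH.exists_isPivot φ
  refine ⟨p, hp.1, lt_of_le_of_ne (hp.2.2 v hv.1 hv.2.1) fun h => hv.2.2 ?_⟩
  rwa [← φ.injective h]

end Pivot

/-! ### Dumbbells -/

/-- A global subordinate vertex of an induced subgraph of a derived graph lies strictly below some
vertex of a hole through it, in the tree of the larger graph. -/
theorem IsGlobalSubordinate.exists_reachable_lt {V W : Type*} {G : SimpleGraph V}
    {D : SimpleGraph W} {x : V} (hx : IsGlobalSubordinate G x) (f : G ↪g D) {T : BurlingTree}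
    (ψ : D ↪g T.fullyDerived.toSimpleGraphInclusive) :
    ∃ p, G.Reachable x p ∧ ψ (f p) < ψ (f x) := by
  let D' : Digraph V := ⟨fun a b => T.fullyDerived.Adj (ψ (f a)) (ψ (f b))⟩
  let φ : DerivedEmbedding D' T :=
    ⟨f.toEmbedding.trans ψ.toEmbedding, Iff.rfl⟩
  have hD' : D'.toSimpleGraphInclusive = G := by
    ext a b
    rw [← f.map_adj_iff, ← ψ.map_adj_iff]
    exact and_congr_left' (by simp)
  obtain ⟨H, hH, hs⟩ := hx D' hD' T φ
  obtain ⟨p, hp, hlt⟩ := hs.exists_lt (hD'.symm ▸ hH)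
  obtain ⟨u, c, -, -, -, rfl⟩ := hH
  classical
  have hxH : x ∈ c.support := hs.1
  exact ⟨p, (c.takeUntil x hxH).reachable.symm.trans (c.takeUntil p hp).reachable, hlt⟩

/-- Trapping along a walk: if `p` is a strict ancestor of the start of the walk and of each vertex of
the walk that is adjacent to `p`, then it is a strict ancestor of the end of the walk. -/
theorem SimpleGraph.Walk.lt_of_forall_not_adj {W : Type*} {D : SimpleGraph W} {T : BurlingTree}
    (ψ : D ↪g T.fullyDerived.toSimpleGraphInclusive) {p u v : W} (q : D.Walk u v)
    (hu : ψ p < ψ u) (hq : ∀ w ∈ q.support, ψ p < ψ w ∨ ¬ D.Adj w p) : ψ p < ψ v := by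
  induction q with
  | nil => exact hu
  | @cons u w v h q ih =>
    refine ih ?_ fun z hz => hq z (by simp [hz])
    rcases hq w (by simp) with h1 | h1
    · exact h1
    rcases BurlingTree.lt_or_adj_of_lt_of_adj hu (ψ.map_adj_iff.2 h).2 with h2 | h2
    · exact h2
    · exact absurd (ψ.map_adj_iff.1 ⟨BurlingTree.ne_of_adj h2, Or.inl h2⟩) h1

/-- In a derived dumbbell, a vertex `p` of `G₁` that is a strict ancestor of `x₁` is a strict
ancestor of everything that `x₂` reaches in `G₂`. -/
theorem lt_of_reachable_of_dumbbell {V₁ V₂ W : Type*} {G₁ : SimpleGraph V₁}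
    {G₂ : SimpleGraph V₂} {x₁ : V₁} {x₂ : V₂} {D : SimpleGraph W} (f₁ : G₁ ↪g D) (f₂ : G₂ ↪g D)
    (q : D.Walk (f₁ x₁) (f₂ x₂))
    (hq₁ : Set.range f₁ ∩ {w | w ∈ q.support} = {f₁ x₁})
    (h₁₂ : Set.range f₁ ∩ Set.range f₂ ⊆ {f₁ x₁})
    (hadj : ∀ u v, D.Adj u v →
      (∃ a b, G₁.Adj a b ∧ f₁ a = u ∧ f₁ b = v) ∨
      (∃ a b, G₂.Adj a b ∧ f₂ a = u ∧ f₂ b = v) ∨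
      s(u, v) ∈ q.edges)
    {T : BurlingTree} (ψ : D ↪g T.fullyDerived.toSimpleGraphInclusive) {p : V₁}
    (hp : ψ (f₁ p) < ψ (f₁ x₁)) {y : V₂} (hy : G₂.Reachable x₂ y) :
    ψ (f₁ p) < ψ (f₂ y) := by
  obtain ⟨r⟩ := hy
  have hpx : f₁ p ≠ f₁ x₁ := fun h => hp.ne (by rw [h])
  -- Outside `G₁`, the vertex `p` has no neighbor; inside, only `x₁` is met.
  have key : ∀ w, (w ∈ Set.range f₁ → w = f₁ x₁) → ψ (f₁ p) < ψ w ∨ ¬ D.Adj w (f₁ p) := by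
    intro w hw
    by_cases h : w = f₁ x₁
    · exact Or.inl (h ▸ hp)
    refine Or.inr fun hwp => ?_
    rcases hadj _ _ hwp with ⟨a, b, -, rfl, -⟩ | ⟨a, b, -, -, hb⟩ | he
    · exact h (hw ⟨a, rfl⟩)
    · exact hpx (h₁₂ ⟨⟨p, rfl⟩, ⟨b, hb⟩⟩)
    · exact hpx (hq₁.subset ⟨⟨p, rfl⟩, q.snd_mem_support_of_mem_edges he⟩)
  refine Walk.lt_of_forall_not_adj ψ (q.append (r.map f₂.toHom)) hp fun w hw => key w fun hw₁ => ?_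
  rw [Walk.mem_support_append_iff] at hw
  rcases hw with hw | hw
  · exact hq₁.subset ⟨hw₁, hw⟩
  · rw [Walk.support_map, List.mem_map] at hw
    obtain ⟨z, -, rfl⟩ := hw
    exact h₁₂ ⟨hw₁, ⟨z, rfl⟩⟩

theorem mainTheorem9 {V₁ V₂ W : Type*}
    (G₁ : SimpleGraph V₁) (G₂ : SimpleGraph V₂)
    (hG₁ : IsDerivedGraph G₁) (hG₂ : IsDerivedGraph G₂)
    (x₁ : V₁) (x₂ : V₂)
    (hx₁ : IsGlobalSubordinate G₁ x₁) (hx₂ : IsGlobalSubordinate G₂ x₂)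
    (D : SimpleGraph W) (hD : IsDumbbell G₁ G₂ x₁ x₂ D) :
    ¬ IsDerivedGraph D := by
  rintro ⟨T, ⟨ψ⟩⟩
  obtain ⟨f₁, f₂, q, -, hq₁, hq₂, h₁₂, -, hadj⟩ := hD
  obtain ⟨p₁, hr₁, hp₁⟩ := hx₁.exists_reachable_lt f₁ ψ
  obtain ⟨p₂, hr₂, hp₂⟩ := hx₂.exists_reachable_lt f₂ ψ
  have hlt : ψ (f₁ p₁) < ψ (f₂ p₂) :=
    lt_of_reachable_of_dumbbell f₁ f₂ q hq₁ (h₁₂.subset.trans Set.inter_subset_left) hadj ψ hp₁ hr₂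
  have hgt : ψ (f₂ p₂) < ψ (f₁ p₁) := by
    refine lt_of_reachable_of_dumbbell f₂ f₁ q.reverse (by simpa using hq₂) ?_ ?_ ψ hp₂ hr₁
    · rw [Set.inter_comm]
      exact h₁₂.subset.trans Set.inter_subset_right
    · intro u v huv
      rw [Walk.edges_reverse, List.mem_reverse]
      exact or_left_comm.1 (hadj u v huv)
  exact lt_asymm hlt hgt
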